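/- Let $\mathbb D=\{z\in\mathbb C:|z|<1\}$ and, for $w:\mathbb D\to\mathbb R$, let $Z(w)=\{z\in\mathbb D: w(z)=0\}$. Let $(u_n)_{n\in\mathbb N}$ and $(v_n)_{n\in\mathbb N}$ be sequences of real-valued harmonic functions in $\mathbb D$ with $Z(u_n)=Z(v_n)$ for every $n$, and let $f_n:\mathbb D\to\mathbb R$ be continuous functions with $f_n>0$ and $u_n=f_nv_n$ in $\mathbb D$ (so $f_n$ is the continuous extension to $\mathbb D$ of the ratio $u_n/v_n$ when $v_n\not\equiv 0$). Suppose that $u_n\to u$ and $v_n\to v$ uniformly on compact subsets of $\mathbb D$, where neither $u$ nor $v$ is identically zero in $\mathbb D$. Then for every non-empty compact set $K\subset\mathbb D$, \[\sup_{n}\ \frac{\sup_K f_n}{\inf_K f_n}<+\infty .\] -/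

import Mathlib

/-- The open unit disc in the plane. -/
def openUnitDisc : Set ℂ := Metric.ball (0 : ℂ) 1

/-- The zero set, within the unit disc, of a real function on the disc.
Functions on the disc are represented by total functions on the plane; only their
values on the disc are used. -/
def discZeroSet (u : ℂ → ℝ) : Set ℂ := {z | z ∈ openUnitDisc ∧ u z = 0}

/-- Uniform convergence on all compact subsets of the unit disc. -/
def TendstoUnifOnCompactsOfDisc (u : ℕ → ℂ → ℝ) (U : ℂ → ℝ) : Prop :=
  ∀ L : Set ℂ, IsCompact L → L ⊆ openUnitDisc →
    TendstoUniformlyOn u U Filter.atTop L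

open Metric Filter Set Topology

/-! By the symmetry `(u, v, f) ↔ (v, u, f⁻¹)` it suffices to bound `f n` above on `K` for large `n`.
The proof passes from a circle to the disc it bounds. Choose a circle around `K` on which the limit
`V` has no critical zero (`exists_sphere_no_critical_zero`). Near a point of the circle where `V ≠
0`, the bound `|u n| ≤ C * |v n|` is immediate. Near a noncritical zero, `v n` grows linearly away
from its zeros, uniformly in `n`, and `u n` vanishes at those zeros (`abs_re_le_of_deriv_near`).
Compactness gives one `C` for the circle. The maximum principle on `{v n > 0}` and on `{v n < 0}`
carries `f n ≤ C` inside, off the zeros of `v n` (`re_le_mul_re_of_sphere`); continuity and density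
give the rest. -/

/-! ### Identity and maximum principles -/

/-- The zeros of a harmonic function that does not vanish identically on a preconnected set have
empty interior. -/
theorem harmonic_frequently_ne_zero {v : ℂ → ℝ} {S : Set ℂ} (hS : IsPreconnected S)
    (hv : InnerProductSpace.HarmonicOnNhd v S) {p z : ℂ} (hp : p ∈ S) (hvp : v p ≠ 0)
    (hz : z ∈ S) : ∃ᶠ w in 𝓝 z, v w ≠ 0 := by
  intro h
  have han : AnalyticOnNhd ℝ v S := fun x hx => HarmonicAt.analyticAt (hv x hx)
  refine hvp (han.eqOn_zero_of_preconnected_of_eventuallyEq_zero hS hz ?_ hp)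
  filter_upwards [h] with w hw
  simpa using hw

/-- Maximum principle for the ratio of the real parts of two holomorphic functions. -/
theorem re_le_mul_re_of_sphere {F G : ℂ → ℂ} {R C : ℝ}
    (hF : ∀ z ∈ closedBall (0 : ℂ) R, DifferentiableAt ℂ F z)
    (hG : ∀ z ∈ closedBall (0 : ℂ) R, DifferentiableAt ℂ G z)
    (hzero : ∀ z ∈ closedBall (0 : ℂ) R, (F z).re = 0 → (G z).re = 0)
    (hsphere : ∀ z ∈ sphere (0 : ℂ) R, 0 ≤ (F z).re → (G z).re ≤ C * (F z).re)
    {z : ℂ} (hz : z ∈ ball (0 : ℂ) R) (hFz : 0 < (F z).re) :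
    (G z).re ≤ C * (F z).re := by
  set W : Set ℂ := ball (0 : ℂ) R ∩ {w | 0 < (F w).re} with hW
  have hcont : ContinuousOn (fun w => (F w).re) (closedBall (0 : ℂ) R) := fun w hw =>
    (Complex.continuous_re.continuousAt.comp (hF w hw).continuousAt).continuousWithinAt
  have hWo : IsOpen W :=
    (hcont.mono ball_subset_closedBall).isOpen_inter_preimage isOpen_ball isOpen_Ioi
  have hWcl : closure W ⊆ closedBall (0 : ℂ) R :=
    (closure_mono inter_subset_left).trans closure_ball_subset_closedBall
  have hcl_nonneg : ∀ w ∈ closure W, 0 ≤ (F w).re := fun w hw =>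
    (closure_minimal (t := closedBall (0 : ℂ) R ∩ (fun w => (F w).re) ⁻¹' Ici 0)
      (fun x hx => ⟨ball_subset_closedBall hx.1, (show 0 < (F x).re from hx.2).le⟩)
      (hcont.preimage_isClosed_of_isClosed isClosed_closedBall isClosed_Ici) hw).2
  -- The modulus of this exponential is `exp (Re G - C * Re F)`, so the maximum modulus principle
  -- applies to a real part.
  have hd : ∀ w ∈ closedBall (0 : ℂ) R,
      DifferentiableAt ℂ (fun w => Complex.exp (G w - C * F w)) w := fun w hw =>
    ((hG w hw).sub ((hF w hw).const_mul _)).cexp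
  have hdc : DiffContOnCl ℂ (fun w => Complex.exp (G w - C * F w)) W := by
    refine DifferentiableOn.diffContOnCl fun w hw => ?_
    exact (hd w (hWcl hw)).differentiableWithinAt
  have hnorm : ∀ w, ‖Complex.exp (G w - C * F w)‖ = Real.exp ((G w).re - C * (F w).re) := by
    intro w
    simp [Complex.norm_exp]
  have hfr : ∀ w ∈ frontier W, ‖Complex.exp (G w - C * F w)‖ ≤ 1 := by
    intro w hw
    rw [hnorm, Real.exp_le_one_iff, sub_nonpos]
    have hwcl := frontier_subset_closure hw
    have hwb := hWcl hwcl
    have h0 := hcl_nonneg w hwcl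
    by_cases hws : w ∈ sphere (0 : ℂ) R
    · exact hsphere w hws h0
    · have hwball : w ∈ ball (0 : ℂ) R := by
        rw [← ball_union_sphere] at hwb
        exact hwb.resolve_right hws
      have hF0 : (F w).re = 0 := by
        by_contra hne
        rw [hWo.frontier_eq] at hw
        exact hw.2 ⟨hwball, lt_of_le_of_ne h0 (Ne.symm hne)⟩
      rw [hzero w hwb hF0, hF0, mul_zero]
  have := Complex.norm_le_of_forall_mem_frontier_norm_le
    (isBounded_ball.subset inter_subset_left) hdc hfr (subset_closure ⟨hz, hFz⟩)
  rwa [hnorm, Real.exp_le_one_iff, sub_nonpos] at this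

/-! ### Convergence of holomorphic completions -/

/-- Holomorphic functions vanishing at the centre whose real parts converge uniformly on smaller
discs form a uniformly Cauchy sequence on smaller discs. -/
theorem uniformCauchySeqOn_of_re {H : ℕ → ℂ → ℂ} {r ρ : ℝ} (hr : 0 ≤ r) (hrρ : r < ρ)
    (hH : ∀ n, DifferentiableOn ℂ (H n) (ball 0 ρ)) (hH0 : ∀ n, H n 0 = 0)
    (hre : UniformCauchySeqOn (fun n z => (H n z).re) atTop (ball 0 ρ)) :
    UniformCauchySeqOn H atTop (closedBall 0 r) := by
  rw [Metric.uniformCauchySeqOn_iff] at hre ⊢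
  intro ε hε
  have hpos : 0 < ρ - r := sub_pos.2 hrρ
  -- Chosen so that the Borel–Carathéodory bound `2δ‖z‖ / (ρ - ‖z‖)` falls below `ε`; `r + 1`
  -- instead of `r` keeps this strict and covers `r = 0`.
  have hδ : 0 < ε * (ρ - r) / (2 * (r + 1)) := by positivity
  obtain ⟨N, hN⟩ := hre _ hδ
  refine ⟨N, fun m hm n hn z hz => ?_⟩
  have hzr : ‖z‖ ≤ r := by simpa using hz
  have hzρ : z ∈ ball (0 : ℂ) ρ := by simpa using hzr.trans_lt hrρ
  have hb := Complex.borelCaratheodory_zero hδ ((hH m).sub (hH n))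
    (fun w hw => by
      have := hN m hm n hn w hw
      rw [Real.dist_eq] at this
      simpa using (abs_lt.1 this).2.le) (hr.trans_lt hrρ) hzρ (by simp [hH0])
  rw [dist_eq_norm]
  refine lt_of_le_of_lt hb ?_
  rw [div_lt_iff₀ (by linarith)]
  have h1 : 2 * (ε * (ρ - r) / (2 * (r + 1))) * ‖z‖ = ε * (ρ - r) * (‖z‖ / (r + 1)) := by
    field_simp
  rw [h1]
  have h2 : ‖z‖ / (r + 1) < 1 := by rw [div_lt_one (by linarith)]; linarith
  calc ε * (ρ - r) * (‖z‖ / (r + 1)) < ε * (ρ - r) * 1 := by gcongr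
    _ ≤ ε * (ρ - ‖z‖) := by rw [mul_one]; gcongr

/-- A compactly convergent sequence of harmonic functions on the disc consists of real parts of
holomorphic functions whose derivatives converge compactly. -/
theorem exists_holomorphic_of_tendsto {u : ℕ → ℂ → ℝ} {U : ℂ → ℝ}
    (hu : ∀ n, InnerProductSpace.HarmonicOnNhd (u n) openUnitDisc)
    (hU : TendstoUnifOnCompactsOfDisc u U) :
    ∃ (F : ℕ → ℂ → ℂ) (Φ : ℂ → ℂ),
      (∀ n, DifferentiableOn ℂ (F n) (ball 0 1)) ∧ DifferentiableOn ℂ Φ (ball 0 1) ∧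
      (∀ n, ∀ z ∈ ball (0 : ℂ) 1, (F n z).re = u n z) ∧
      (∀ z ∈ ball (0 : ℂ) 1, (Φ z).re = U z) ∧
      TendstoLocallyUniformlyOn (fun n => deriv (F n)) (deriv Φ) atTop (ball 0 1) := by
  have hex : ∀ n, ∃ F : ℂ → ℂ, AnalyticOnNhd ℂ F (ball 0 1) ∧
      (ball (0 : ℂ) 1).EqOn (fun z => (F z).re) (u n) := fun n =>
    (hu n).exists_analyticOnNhd_ball_re_eq
  choose F hFan hFre using hex
  have hFd : ∀ n, DifferentiableOn ℂ (F n) (ball 0 1) := fun n => (hFan n).differentiableOn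
  have h0 : (0 : ℂ) ∈ ball (0 : ℂ) 1 := by simp
  have hpt : ∀ z ∈ ball (0 : ℂ) 1, Tendsto (fun n => u n z) atTop (𝓝 (U z)) := fun z hz =>
    (hU {z} isCompact_singleton (by simpa [openUnitDisc] using hz)).tendsto_at rfl
  -- Imaginary parts are determined only up to constants, so `F n` itself need not converge;
  -- normalising at `0` leaves derivatives unchanged.
  set H : ℕ → ℂ → ℂ := fun n z => F n z - F n 0 with hH
  have hHd : ∀ n, DifferentiableOn ℂ (H n) (ball 0 1) := fun n => (hFd n).sub_const _
  have hC : ∀ r : ℝ, 0 ≤ r → r < 1 → UniformCauchySeqOn H atTop (closedBall 0 r) := by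
    intro r hr hr1
    have hρ1 : (r + 1) / 2 < 1 := by linarith
    have hsub : ball (0 : ℂ) ((r + 1) / 2) ⊆ ball 0 1 := ball_subset_ball hρ1.le
    refine uniformCauchySeqOn_of_re (ρ := (r + 1) / 2) hr (by linarith)
      (fun n => (hHd n).mono hsub) (by simp [hH]) ?_
    have h1 : UniformCauchySeqOn u atTop (ball 0 ((r + 1) / 2)) :=
      (hU _ (isCompact_closedBall 0 ((r + 1) / 2))
        (closedBall_subset_ball hρ1)).uniformCauchySeqOn.mono ball_subset_closedBall
    rw [Metric.uniformCauchySeqOn_iff] at h1 ⊢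
    intro ε hε
    obtain ⟨N, hN⟩ := h1 (ε / 2) (by linarith)
    refine ⟨N, fun m hm n hn z hz => ?_⟩
    have e1 := hN m hm n hn z hz
    have e2 := hN m hm n hn 0 (by simp; linarith)
    simp only [hH, Complex.sub_re]
    have r1 := fun k => hFre k (hsub hz)
    have r2 := fun k => hFre k h0
    simp only at r1 r2
    rw [r1, r1, r2, r2]
    rw [Real.dist_eq, abs_lt] at *
    constructor <;> linarith [e1.1, e1.2, e2.1, e2.2]
  have hlim : ∀ z ∈ ball (0 : ℂ) 1, ∃ l, Tendsto (fun n => H n z) atTop (𝓝 l) := by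
    intro z hz
    have hz1 : ‖z‖ < 1 := by simpa using hz
    exact cauchySeq_tendsto_of_complete
      ((hC ‖z‖ (norm_nonneg _) hz1).cauchySeq (by simp : z ∈ closedBall (0 : ℂ) ‖z‖))
  choose! h hh using hlim
  have hloc : TendstoLocallyUniformlyOn H h atTop (ball 0 1) := by
    rw [tendstoLocallyUniformlyOn_iff_forall_isCompact isOpen_ball]
    intro K hK1 hK
    obtain ⟨r, hr, hKr⟩ := exists_pos_lt_subset_ball one_pos hK.isClosed hK1
    refine ((hC r hr.1.le hr.2).tendstoUniformlyOn_of_tendsto fun z hz => hh z ?_).mono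
      (hKr.trans ball_subset_closedBall)
    exact closedBall_subset_ball hr.2 hz
  have hhd : DifferentiableOn ℂ h (ball 0 1) :=
    hloc.differentiableOn (Eventually.of_forall hHd) isOpen_ball
  refine ⟨F, fun z => h z + (U 0 : ℂ), hFd, hhd.add_const _, fun n z hz => hFre n hz, ?_, ?_⟩
  · intro z hz
    have t1 : Tendsto (fun n => (H n z).re) atTop (𝓝 (h z).re) :=
      (Complex.continuous_re.tendsto _).comp (hh z hz)
    have t2 : Tendsto (fun n => (H n z).re) atTop (𝓝 (U z - U 0)) := by
      refine ((hpt z hz).sub (hpt 0 h0)).congr fun n => ?_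
      have r1 := hFre n hz
      have r2 := hFre n h0
      simp only at r1 r2
      simp [hH, r1, r2]
    have := tendsto_nhds_unique t1 t2
    simp [this]
  · have := hloc.deriv (Eventually.of_forall hHd) isOpen_ball
    have e1 : (deriv ∘ H) = fun n => deriv (F n) := by
      funext n z
      simp [hH, deriv_sub_const]
    have e2 : deriv (fun z => h z + (U 0 : ℂ)) = deriv h := by
      funext z
      simp
    rwa [e1, ← e2] at this

/-! ### Comparison on a circle -/

/-- Along the direction `a⁻¹`, `Re F` increases at a rate between `1/2` and `3/2`. A zero of `Re F`
therefore lies at some parameter `t` with `|t| ≤ 2 * |Re F z|`; `Re G` vanishes there too, and the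
bound on `deriv G` controls it back at `z`. -/
theorem abs_re_le_of_deriv_near {F G : ℂ → ℂ} {p a z : ℂ} {δ M T : ℝ} (ha : a ≠ 0)
    (hF : ∀ w ∈ ball p δ, DifferentiableAt ℂ F w) (hG : ∀ w ∈ ball p δ, DifferentiableAt ℂ G w)
    (hF' : ∀ w ∈ ball p δ, ‖deriv F w - a‖ ≤ ‖a‖ / 2) (hG' : ∀ w ∈ ball p δ, ‖deriv G w‖ ≤ M)
    (hzero : ∀ w ∈ ball p δ, (F w).re = 0 → (G w).re = 0) (hT : 0 ≤ T)
    (hz : ‖z - p‖ + T * ‖a⁻¹‖ < δ) (hFz : |(F z).re| ≤ T / 2) :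
    |(G z).re| ≤ 2 * M * ‖a⁻¹‖ * |(F z).re| := by
  have hmem : ∀ t : ℝ, |t| ≤ T → z + t * a⁻¹ ∈ ball p δ := by
    intro t ht
    rw [mem_ball_iff_norm, add_sub_right_comm]
    calc ‖z - p + t * a⁻¹‖ ≤ ‖z - p‖ + ‖(t : ℂ) * a⁻¹‖ := norm_add_le _ _
      _ = ‖z - p‖ + |t| * ‖a⁻¹‖ := by rw [norm_mul, Complex.norm_real, Real.norm_eq_abs]
      _ ≤ ‖z - p‖ + T * ‖a⁻¹‖ := by gcongr
      _ < δ := hz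
  have hzb : z ∈ ball p δ := by simpa using hmem 0 (by simpa using hT)
  have hlin : ∀ t : ℝ, |t| ≤ T → |(F (z + t * a⁻¹)).re - (F z).re - t| ≤ |t| / 2 := by
    intro t ht
    -- Mean value inequality for `F w - w * a`; the linear part contributes exactly `t` along `t *
    -- a⁻¹`.
    have := (convex_ball p δ).norm_image_sub_le_of_norm_hasDerivWithin_le
      (f := fun w => F w - w * a) (f' := fun w => deriv F w - 1 * a) (C := ‖a‖ / 2)
      (fun w hw => ((hF w hw).hasDerivAt.sub ((hasDerivAt_id w).mul_const a)).hasDerivWithinAt)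
      (fun w hw => by simpa using hF' w hw) hzb (hmem t ht)
    have e1 : (F (z + t * a⁻¹) - (z + t * a⁻¹) * a) - (F z - z * a)
        = F (z + t * a⁻¹) - F z - t := by
      field_simp
      ring
    have e2 : ‖a‖ / 2 * ‖z + t * a⁻¹ - z‖ = |t| / 2 := by
      rw [add_sub_cancel_left, norm_mul, norm_inv, Complex.norm_real, Real.norm_eq_abs]
      have : ‖a‖ ≠ 0 := norm_ne_zero_iff.2 ha
      field_simp
    rw [e1, e2] at this
    refine le_trans ?_ this
    simpa using Complex.abs_re_le_norm (F (z + t * a⁻¹) - F z - t)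
  have hFz' := abs_le.1 hFz
  have hcont : ContinuousOn (fun t : ℝ => (F (z + t * a⁻¹)).re) (Icc (-T) T) := by
    intro t ht
    have h1 : ContinuousAt F (z + t * a⁻¹) := (hF _ (hmem t (abs_le.2 ht))).continuousAt
    have h2 : ContinuousAt (fun t : ℝ => z + (t : ℂ) * a⁻¹) t := by fun_prop
    have h3 : ContinuousAt (fun t : ℝ => F (z + (t : ℂ) * a⁻¹)) t :=
      ContinuousAt.comp (f := fun t : ℝ => z + (t : ℂ) * a⁻¹) h1 h2
    exact (Complex.continuous_re.continuousAt.comp h3).continuousWithinAt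
  have hmid : (0 : ℝ) ∈ Icc (F (z + (-T : ℝ) * a⁻¹)).re (F (z + (T : ℝ) * a⁻¹)).re := by
    have h1 := hlin (-T) (by rw [abs_neg, abs_of_nonneg hT])
    have h2 := hlin T (by rw [abs_of_nonneg hT])
    rw [abs_neg, abs_of_nonneg hT] at h1
    rw [abs_of_nonneg hT] at h2
    rw [abs_le] at h1 h2
    constructor <;> linarith [h1.1, h1.2, h2.1, h2.2]
  obtain ⟨t, ht, ht0⟩ := intermediate_value_Icc (by linarith : -T ≤ T) hcont hmid
  have htT := abs_le.2 ht
  have hG0 := hzero _ (hmem t htT) ht0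
  have h1 := hlin t htT
  simp only at ht0
  have htF : |t| / 2 ≤ |(F z).re| := by
    rw [ht0, zero_sub, ← abs_neg] at h1
    have h2 := abs_sub_abs_le_abs_sub t (-(F z).re)
    rw [abs_neg] at h2
    have h3 : |(-(-(F z).re - t))| = |t - -(F z).re| := by congr 1; ring
    linarith
  have hGd := (convex_ball p δ).norm_image_sub_le_of_norm_hasDerivWithin_le
      (fun w hw => (hG w hw).hasDerivAt.hasDerivWithinAt) hG' (hmem t htT) hzb
  have hM : 0 ≤ M := (norm_nonneg _).trans (hG' z hzb)
  have e : ‖z - (z + t * a⁻¹)‖ = |t| * ‖a⁻¹‖ := by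
    rw [sub_add_cancel_left, norm_neg, norm_mul, Complex.norm_real, Real.norm_eq_abs]
  calc |(G z).re| = |(G z - G (z + t * a⁻¹)).re| := by rw [Complex.sub_re, hG0, sub_zero]
    _ ≤ M * (|t| * ‖a⁻¹‖) := (Complex.abs_re_le_norm _).trans (hGd.trans_eq (by rw [e]))
    _ ≤ M * ((2 * |(F z).re|) * ‖a⁻¹‖) := by gcongr; linarith
    _ = _ := by ring

/-- Locally uniform convergence to a continuous limit gives uniform closeness to the value of the
limit near a point. -/
theorem eventually_eventually_norm_sub_lt {E : Type*} [SeminormedAddCommGroup E]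
    {g : ℕ → ℂ → E} {γ : ℂ → E} {S : Set ℂ} (hS : IsOpen S)
    (h : TendstoLocallyUniformlyOn g γ atTop S) (hγ : ContinuousOn γ S) {p : ℂ} (hp : p ∈ S)
    {ε : ℝ} (hε : 0 < ε) :
    ∃ t ∈ 𝓝 p, ∀ᶠ n in atTop, ∀ z ∈ t, ‖g n z - γ p‖ < ε := by
  rw [Metric.tendstoLocallyUniformlyOn_iff] at h
  obtain ⟨t, ht, htn⟩ := h (ε / 2) (half_pos hε) p hp
  rw [hS.nhdsWithin_eq hp] at ht
  have hγp := (hγ.continuousAt (hS.mem_nhds hp)).eventually (ball_mem_nhds _ (half_pos hε))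
  refine ⟨_, inter_mem ht hγp, htn.mono fun n hn z hz => ?_⟩
  have h1 := hn z hz.1
  have h2 : dist (γ z) (γ p) < ε / 2 := hz.2
  rw [← dist_eq_norm]
  linarith [dist_triangle_left (g n z) (γ p) (γ z)]

/-- There are circles of radius close to one on which a nonzero harmonic function has no critical
zero. -/
theorem exists_sphere_no_critical_zero {Φ : ℂ → ℂ} (hΦ : DifferentiableOn ℂ Φ (ball 0 1))
    (hne : ∃ z ∈ ball (0 : ℂ) 1, (Φ z).re ≠ 0) {r : ℝ} (hr1 : r < 1) :
    ∃ R ∈ Ioo r 1, ∀ z ∈ sphere (0 : ℂ) R, (Φ z).re ≠ 0 ∨ deriv Φ z ≠ 0 := by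
  have han : AnalyticOnNhd ℂ (deriv Φ) (ball 0 1) := (hΦ.analyticOnNhd isOpen_ball).deriv
  have hpre : IsPreconnected (ball (0 : ℂ) 1) := (convex_ball _ _).isPreconnected
  rcases han.eqOn_zero_or_eventually_ne_zero_of_preconnected hpre with h | h
  · obtain ⟨p, hp, hpne⟩ := hne
    refine ⟨(r + 1) / 2, ⟨by linarith, by linarith⟩, fun z hz => Or.inl ?_⟩
    have hz1 : z ∈ ball (0 : ℂ) 1 := by
      rw [mem_sphere_zero_iff_norm] at hz
      rw [mem_ball_zero_iff]
      linarith
    rwa [isOpen_ball.is_const_of_deriv_eq_zero hpre hΦ h hz1 hp]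
  · have hsub : closedBall (0 : ℂ) ((r + 1) / 2) ⊆ ball 0 1 :=
      closedBall_subset_ball (by linarith)
    -- Critical points are finite in number on a smaller closed disc, so only finitely many radii
    -- are excluded.
    have hfin := (isCompact_closedBall (0 : ℂ) ((r + 1) / 2)).finite_sdiff_of_mem_codiscreteWithin
      (codiscreteWithin_mono hsub h)
    obtain ⟨R, hR, hRn⟩ :=
      (Ioo_infinite (by linarith : r < (r + 1) / 2)).exists_notMem_finite (hfin.image norm)
    refine ⟨R, ⟨hR.1, by linarith [hR.2]⟩, fun z hz => Or.inr fun hz0 => hRn ?_⟩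
    rw [mem_sphere_zero_iff_norm] at hz
    exact ⟨z, ⟨by simpa [hz] using hR.2.le, by simpa using hz0⟩, hz⟩

theorem exists_nhds_abs_le_mul_abs {u v : ℕ → ℂ → ℝ} {V : ℂ → ℝ} {F G : ℕ → ℂ → ℂ} {Φ Γ : ℂ → ℂ}
    (hF : ∀ n, DifferentiableOn ℂ (F n) (ball 0 1)) (hΦ : DifferentiableOn ℂ Φ (ball 0 1))
    (hFre : ∀ n, ∀ z ∈ ball (0 : ℂ) 1, (F n z).re = v n z)
    (hΦre : ∀ z ∈ ball (0 : ℂ) 1, (Φ z).re = V z)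
    (hFΦ : TendstoLocallyUniformlyOn (fun n => deriv (F n)) (deriv Φ) atTop (ball 0 1))
    (hG : ∀ n, DifferentiableOn ℂ (G n) (ball 0 1)) (hΓ : DifferentiableOn ℂ Γ (ball 0 1))
    (hGre : ∀ n, ∀ z ∈ ball (0 : ℂ) 1, (G n z).re = u n z)
    (hGΓ : TendstoLocallyUniformlyOn (fun n => deriv (G n)) (deriv Γ) atTop (ball 0 1))
    (hV : TendstoLocallyUniformlyOn v V atTop (ball 0 1))
    (hzero : ∀ n, ∀ z ∈ ball (0 : ℂ) 1, v n z = 0 → u n z = 0)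
    {p : ℂ} (hp : p ∈ ball (0 : ℂ) 1) (hVp : V p = 0) (hp' : deriv Φ p ≠ 0) :
    ∃ C, ∃ t ∈ 𝓝 p, ∀ᶠ n in atTop, ∀ z ∈ t, |u n z| ≤ C * |v n z| := by
  set a := deriv Φ p with ha
  have hVc : ContinuousOn V (ball 0 1) :=
    (Complex.continuous_re.comp_continuousOn hΦ.continuousOn).congr fun z hz => (hΦre z hz).symm
  have ha0 : 0 < ‖a‖ := norm_pos_iff.2 hp'
  obtain ⟨t₁, ht₁, h₁⟩ := eventually_eventually_norm_sub_lt isOpen_ball hFΦ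
    (hΦ.deriv isOpen_ball).continuousOn hp (half_pos ha0)
  obtain ⟨t₂, ht₂, h₂⟩ := eventually_eventually_norm_sub_lt isOpen_ball hGΓ
    (hΓ.deriv isOpen_ball).continuousOn hp one_pos
  obtain ⟨δ, hδ, hδt⟩ := Metric.mem_nhds_iff.1
    (inter_mem (inter_mem ht₁ ht₂) (isOpen_ball.mem_nhds hp))
  -- With `T = δ * ‖a‖ / 2`, the displacement `T * ‖a⁻¹‖` is `δ / 2`, so segments starting in `ball
  -- p (δ / 2)` stay in `ball p δ`.
  have hT : 0 < δ * ‖a‖ / 2 := by positivity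
  obtain ⟨t₃, ht₃, h₃⟩ := eventually_eventually_norm_sub_lt isOpen_ball hV hVc hp (half_pos hT)
  refine ⟨2 * (‖deriv Γ p‖ + 1) * ‖a⁻¹‖, t₃ ∩ ball p (δ / 2),
    inter_mem ht₃ (ball_mem_nhds _ (half_pos hδ)), ?_⟩
  filter_upwards [h₁, h₂, h₃] with n h₁ h₂ h₃ z hz
  have hzp : ‖z - p‖ < δ / 2 := by simpa [dist_eq_norm] using hz.2
  have hzδ : z ∈ ball p δ := ball_subset_ball (by linarith) hz.2
  have hb : ball p δ ⊆ ball 0 1 := fun w hw => (hδt hw).2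
  rw [← hGre n z (hb hzδ), ← hFre n z (hb hzδ)]
  refine abs_re_le_of_deriv_near (p := p) (δ := δ) (T := δ * ‖a‖ / 2) hp'
    (fun w hw => (hF n).differentiableAt (isOpen_ball.mem_nhds (hb hw)))
    (fun w hw => (hG n).differentiableAt (isOpen_ball.mem_nhds (hb hw)))
    (fun w hw => (h₁ w (hδt hw).1.1).le) (fun w hw => ?_) (fun w hw h0 => ?_) hT.le ?_ ?_
  · linarith [norm_le_norm_add_norm_sub' (deriv (G n) w) (deriv Γ p), h₂ w (hδt hw).1.2]
  · rw [hGre n w (hb hw)]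
    exact hzero n w (hb hw) (by rw [← hFre n w (hb hw), h0])
  · have : δ * ‖a‖ / 2 * ‖a⁻¹‖ = δ / 2 := by
      rw [norm_inv]
      field_simp
    linarith
  · have := h₃ z hz.1
    rw [hVp, sub_zero, Real.norm_eq_abs] at this
    rw [hFre n z (hb hzδ)]
    exact this.le

theorem exists_nhds_abs_le_mul_abs_of_ne_zero {u v : ℕ → ℂ → ℝ} {U V : ℂ → ℝ} {S : Set ℂ}
    (hS : IsOpen S) (hU : TendstoLocallyUniformlyOn u U atTop S) (hUc : ContinuousOn U S)
    (hV : TendstoLocallyUniformlyOn v V atTop S) (hVc : ContinuousOn V S)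
    {p : ℂ} (hp : p ∈ S) (hVp : V p ≠ 0) :
    ∃ C, ∃ t ∈ 𝓝 p, ∀ᶠ n in atTop, ∀ z ∈ t, |u n z| ≤ C * |v n z| := by
  have hVpos : 0 < |V p| := abs_pos.2 hVp
  obtain ⟨t₁, ht₁, h₁⟩ := eventually_eventually_norm_sub_lt hS hU hUc hp one_pos
  obtain ⟨t₂, ht₂, h₂⟩ := eventually_eventually_norm_sub_lt hS hV hVc hp (half_pos hVpos)
  refine ⟨(|U p| + 1) / (|V p| / 2), _, inter_mem ht₁ ht₂, ?_⟩
  filter_upwards [h₁, h₂] with n h₁ h₂ z hz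
  have e1 := h₁ z hz.1
  have e2 := h₂ z hz.2
  rw [Real.norm_eq_abs] at e1 e2
  have e3 : |u n z| ≤ |U p| + 1 := by linarith [abs_sub_abs_le_abs_sub (u n z) (U p)]
  have e4 : |V p| / 2 ≤ |v n z| := by
    linarith [abs_sub_abs_le_abs_sub (V p) (v n z), abs_sub_comm (V p) (v n z)]
  calc |u n z| ≤ |U p| + 1 := e3
    _ = (|U p| + 1) / (|V p| / 2) * (|V p| / 2) := by field_simp
    _ ≤ _ := by gcongr

/-! ### Upper bound for the ratio -/

theorem eventually_ratio_le {u v f : ℕ → ℂ → ℝ} {U V : ℂ → ℝ}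
    (hu : ∀ n, InnerProductSpace.HarmonicOnNhd (u n) openUnitDisc)
    (hv : ∀ n, InnerProductSpace.HarmonicOnNhd (v n) openUnitDisc)
    (hf_cont : ∀ n, ContinuousOn (f n) openUnitDisc)
    (hf_mul : ∀ n, ∀ z ∈ openUnitDisc, u n z = f n z * v n z)
    (hU : TendstoUnifOnCompactsOfDisc u U) (hV : TendstoUnifOnCompactsOfDisc v V)
    (hV_ne : ∃ z ∈ openUnitDisc, V z ≠ 0)
    {K : Set ℂ} (hK : IsCompact K) (hKD : K ⊆ openUnitDisc) :
    ∃ C, ∀ᶠ n in atTop, ∀ z ∈ K, f n z ≤ C := by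
  obtain ⟨G, Γ, hG, hΓ, hGre, hΓre, hGΓ⟩ := exists_holomorphic_of_tendsto hu hU
  obtain ⟨F, Φ, hF, hΦ, hFre, hΦre, hFΦ⟩ := exists_holomorphic_of_tendsto hv hV
  unfold openUnitDisc at *
  have hloc : ∀ {w : ℕ → ℂ → ℝ} {W : ℂ → ℝ}, TendstoUnifOnCompactsOfDisc w W →
      TendstoLocallyUniformlyOn w W atTop (ball 0 1) := fun hW =>
    (tendstoLocallyUniformlyOn_iff_forall_isCompact isOpen_ball).2 fun L hL hLc => hW L hLc hL
  have hUc : ContinuousOn U (ball 0 1) :=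
    (Complex.continuous_re.comp_continuousOn hΓ.continuousOn).congr fun z hz => (hΓre z hz).symm
  have hVc : ContinuousOn V (ball 0 1) :=
    (Complex.continuous_re.comp_continuousOn hΦ.continuousOn).congr fun z hz => (hΦre z hz).symm
  obtain ⟨p, hp, hpne⟩ := hV_ne
  obtain ⟨r, hr, hKr⟩ := exists_pos_lt_subset_ball one_pos hK.isClosed hKD
  obtain ⟨R, hR, hRne⟩ := exists_sphere_no_critical_zero hΦ ⟨p, hp, by rwa [hΦre p hp]⟩ hr.2
  have hcb : closedBall (0 : ℂ) R ⊆ ball 0 1 := closedBall_subset_ball hR.2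
  have hzero : ∀ n, ∀ z ∈ ball (0 : ℂ) 1, v n z = 0 → u n z = 0 := fun n z hz h => by
    rw [hf_mul n z hz, h, mul_zero]
  obtain ⟨C, hC⟩ : ∃ C, ∀ᶠ n in atTop, ∀ z ∈ sphere (0 : ℂ) R, |u n z| ≤ C * |v n z| := by
    refine (isCompact_sphere (0 : ℂ) R).induction_on
      (p := fun s => ∃ C, ∀ᶠ n in atTop, ∀ z ∈ s, |u n z| ≤ C * |v n z|) ⟨0, by simp⟩
      (fun s t hst ⟨C, h⟩ => ⟨C, h.mono fun n hn z hz => hn z (hst hz)⟩) ?_ ?_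
    · rintro s t ⟨C₁, h₁⟩ ⟨C₂, h₂⟩
      refine ⟨max C₁ C₂, ?_⟩
      filter_upwards [h₁, h₂] with n h₁ h₂ z hz
      rcases hz with hz | hz
      · exact (h₁ z hz).trans (by gcongr; exact le_max_left _ _)
      · exact (h₂ z hz).trans (by gcongr; exact le_max_right _ _)
    · intro z hz
      have hz1 := hcb (sphere_subset_closedBall hz)
      have : ∃ C, ∃ t ∈ 𝓝 z, ∀ᶠ n in atTop, ∀ z ∈ t, |u n z| ≤ C * |v n z| := by
        by_cases hVz : V z = 0
        · refine exists_nhds_abs_le_mul_abs hF hΦ hFre hΦre hFΦ hG hΓ hGre hGΓ (hloc hV) hzero hz1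
            hVz ((hRne z hz).resolve_left ?_)
          rw [hΦre z hz1]
          exact not_not.2 hVz
        · exact exists_nhds_abs_le_mul_abs_of_ne_zero isOpen_ball (hloc hU) hUc (hloc hV) hVc hz1
            hVz
      obtain ⟨C, t, ht, h⟩ := this
      exact ⟨t, mem_nhdsWithin_of_mem_nhds ht, C, h⟩
  -- For large `n`, `v n` is not identically zero, so its zero set has empty interior.
  have hvp : ∀ᶠ n in atTop, v n p ≠ 0 :=
    ((hloc hV).tendsto_at hp).eventually_ne hpne
  refine ⟨C, ?_⟩
  filter_upwards [hC, hvp] with n hCn hvpn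
  have hFd : ∀ z ∈ closedBall (0 : ℂ) R, DifferentiableAt ℂ (F n) z := fun z hz =>
    (hF n).differentiableAt (isOpen_ball.mem_nhds (hcb hz))
  have hGd : ∀ z ∈ closedBall (0 : ℂ) R, DifferentiableAt ℂ (G n) z := fun z hz =>
    (hG n).differentiableAt (isOpen_ball.mem_nhds (hcb hz))
  have hbound : ∀ z ∈ ball (0 : ℂ) R, v n z ≠ 0 → f n z ≤ C := by
    intro z hz hvz
    have hz1 := hcb (ball_subset_closedBall hz)
    rcases lt_or_gt_of_ne hvz with hneg | hpos
    · have := re_le_mul_re_of_sphere (F := -F n) (G := -G n) (C := C) (fun z hz => (hFd z hz).neg)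
        (fun z hz => (hGd z hz).neg)
        (fun w hw h0 => by
          have hw1 := hcb hw
          simp only [Pi.neg_apply, Complex.neg_re, neg_eq_zero, hFre n w hw1, hGre n w hw1] at *
          exact hzero n w hw1 h0)
        (fun w hw h0 => by
          have hw1 := hcb (sphere_subset_closedBall hw)
          simp only [Pi.neg_apply, Complex.neg_re, hFre n w hw1, hGre n w hw1] at *
          have := hCn w hw
          rw [← abs_neg (v n w), abs_of_nonneg h0] at this
          exact (neg_le_abs _).trans this) hz
        (by simpa [hFre n z hz1] using hneg)
      simp only [Pi.neg_apply, Complex.neg_re, hFre n z hz1, hGre n z hz1] at this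
      rw [hf_mul n z hz1] at this
      exact le_of_mul_le_mul_right (by linarith : f n z * -v n z ≤ C * -v n z) (neg_pos.2 hneg)
    · have := re_le_mul_re_of_sphere (C := C) hFd hGd
        (fun w hw h0 => by
          have hw1 := hcb hw
          rw [hFre n w hw1] at h0
          rw [hGre n w hw1]
          exact hzero n w hw1 h0)
        (fun w hw h0 => by
          have hw1 := hcb (sphere_subset_closedBall hw)
          rw [hFre n w hw1] at h0 ⊢
          rw [hGre n w hw1]
          have := hCn w hw
          rw [abs_of_nonneg h0] at this
          exact (le_abs_self _).trans this) hz
        (by rwa [hFre n z hz1])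
      rw [hFre n z hz1, hGre n z hz1, hf_mul n z hz1] at this
      exact le_of_mul_le_mul_right this hpos
  intro z hzK
  have hzR : z ∈ ball (0 : ℂ) R := ball_subset_ball hR.1.le (hKr hzK)
  have hz1 := hcb (ball_subset_closedBall hzR)
  have hfreq := harmonic_frequently_ne_zero (convex_ball (0 : ℂ) 1).isPreconnected (hv n) hp hvpn
    hz1
  -- If the bound failed at `z`, it would fail on a neighbourhood, which contains points with `v n ≠
  -- 0`.
  by_contra hlt
  have hev : ∀ᶠ w in 𝓝 z, C < f n w :=
    ((hf_cont n).continuousAt (isOpen_ball.mem_nhds hz1)).eventually_const_lt (not_le.1 hlt)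
  obtain ⟨w, hw, hwR, hwC⟩ := (hfreq.and_eventually
    ((isOpen_ball.eventually_mem hzR).and hev)).exists
  exact absurd (hbound w hwR hw) (not_le.2 hwC)

/-- Each `f n` is the positive continuous function on the whole disc, zeros included, with
`u n = f n * v n`. On a compact set `K` it is bounded and bounded away from zero, so `sSup` and
`sInf` are the actual supremum and infimum when `K` is non-empty. -/
theorem proposition3p1
    (u v f : ℕ → ℂ → ℝ) (U V : ℂ → ℝ)
    (hu : ∀ n, InnerProductSpace.HarmonicOnNhd (u n) openUnitDisc)
    (hv : ∀ n, InnerProductSpace.HarmonicOnNhd (v n) openUnitDisc)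
    (hZ : ∀ n, discZeroSet (u n) = discZeroSet (v n))
    (hf_cont : ∀ n, ContinuousOn (f n) openUnitDisc)
    (hf_pos : ∀ n, ∀ z ∈ openUnitDisc, 0 < f n z)
    (hf_mul : ∀ n, ∀ z ∈ openUnitDisc, u n z = f n z * v n z)
    (hU : TendstoUnifOnCompactsOfDisc u U)
    (hV : TendstoUnifOnCompactsOfDisc v V)
    (hU_ne : ∃ z ∈ openUnitDisc, U z ≠ 0)
    (hV_ne : ∃ z ∈ openUnitDisc, V z ≠ 0)
    (K : Set ℂ) (hK : IsCompact K) (hKD : K ⊆ openUnitDisc) :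
    BddAbove (Set.range fun n : ℕ => sSup (f n '' K) / sInf (f n '' K)) := by
  rcases K.eq_empty_or_nonempty with rfl | hKne
  · refine ⟨0, ?_⟩
    rintro _ ⟨n, rfl⟩
    simp
  obtain ⟨A, hA⟩ := eventually_ratio_le hu hv hf_cont hf_mul hU hV hV_ne hK hKD
  obtain ⟨B, hB⟩ := eventually_ratio_le (f := fun n z => (f n z)⁻¹) hv hu
    (fun n => (hf_cont n).inv₀ fun z hz => (hf_pos n z hz).ne')
    (fun n z hz => by
      have := (hf_pos n z hz).ne'
      rw [hf_mul n z hz, inv_mul_cancel_left₀ this]) hV hU hU_ne hK hKD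
  -- An eventual bound suffices: the finitely many remaining quotients are real numbers.
  refine IsBoundedUnder.bddAbove_range (isBoundedUnder_of_eventually_le (a := A * B) ?_)
  filter_upwards [hA, hB] with n hAn hBn
  obtain ⟨z, hz⟩ := hKne
  have hB0 : 0 < B := (inv_pos.2 (hf_pos n z (hKD hz))).trans_le (hBn z hz)
  have hA0 : 0 < A := (hf_pos n z (hKD hz)).trans_le (hAn z hz)
  have hsup : sSup (f n '' K) ≤ A := csSup_le ⟨_, z, hz, rfl⟩ (forall_mem_image.2 hAn)
  have hinf : B⁻¹ ≤ sInf (f n '' K) :=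
    le_csInf ⟨_, z, hz, rfl⟩ (forall_mem_image.2 fun w hw =>
      inv_le_of_inv_le₀ (hf_pos n w (hKD hw)) (hBn w hw))
  calc sSup (f n '' K) / sInf (f n '' K) ≤ A / B⁻¹ := by gcongr
    _ = A * B := by rw [div_inv_eq_mul]
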